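/- Let $k$ be an algebraically closed field of characteristic $p>0$, let $e\ge 0$ and $n\ge 1$ be integers, and put $q=p^e$. Let $X=\mathbb V(f)\subset\mathbb P^n$ be a smooth extremal hypersurface: $f\in k[x_0,\dots,x_n]$ is a form of degree $q+1$ lying in the ideal $\langle x_0^{q},\dots,x_n^{q}\rangle$, and the gradient of $f$ vanishes at no point of $X$. For a hyperplane $H=\mathbb V(L)$, with $L\ne 0$ a linear form, consider the hyperplane section $X\cap H=\operatorname{Proj} k[x_0,\dots,x_n]/(f,L)$; it is called smooth if it is smooth as a hypersurface in $H$, that is, if the gradients of $f$ and $L$ are linearly independent at every point of $X\cap H$. Then: 1. any two smooth hyperplane sections of $X$ are isomorphic as schemes over $k$; 2. if $(p,e)\neq(2,0)$, every smooth hyperplane section $X\cap H$ is projectively equivalent to the diagonal hypersurface $\mathbb V\bigl(\sum_{i=1}^{n}x_i^{q+1}\bigr)\subset\mathbb P^{n-1}$, that is, some linear isomorphism $\mathbb P^{n-1}\to H$ pulls $X\cap H$ back to this diagonal hypersurface. -/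

import Mathlib

open MvPolynomial AlgebraicGeometry CategoryTheory

universe u

attribute [local instance] MvPolynomial.gradedAlgebra

noncomputable section

namespace ExtremalHypersurface

/-! ### The projective scheme defined by a homogeneous ideal -/

section Proj

variable {σ : Type} {k : Type u} [Field k]

/-- The degree `d` part of `k[x] / I`: the image of the forms of degree `d`. -/
def quotientGrading (I : HomogeneousIdeal (homogeneousSubmodule σ k)) (d : ℕ) :
    Submodule k (MvPolynomial σ k ⧸ I.toIdeal) :=
  (homogeneousSubmodule σ k d).map (Ideal.Quotient.mkₐ k I.toIdeal).toLinearMap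

instance quotientGrading_gradedMonoid (I : HomogeneousIdeal (homogeneousSubmodule σ k)) :
    SetLike.GradedMonoid (quotientGrading I) where
  one_mem := ⟨1, isHomogeneous_one σ k, rfl⟩
  mul_mem := by
    rintro i j _ _ ⟨a, ha, rfl⟩ ⟨b, hb, rfl⟩
    exact ⟨a * b, IsHomogeneous.mul ha hb, map_mul (Ideal.Quotient.mk I.toIdeal) a b⟩

/-- The map sending a polynomial to the family of the classes mod `I` of its homogeneous parts. -/
def quotientDecomposeAux (I : HomogeneousIdeal (homogeneousSubmodule σ k)) :
    MvPolynomial σ k →ₗ[k] DirectSum ℕ fun d => quotientGrading I d :=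
  (DirectSum.lmap fun d =>
    ((Ideal.Quotient.mkₐ k I.toIdeal).toLinearMap.restrict
      (p := homogeneousSubmodule σ k d) (q := quotientGrading I d)
      fun f hf => ⟨f, hf, rfl⟩)) ∘ₗ
  (DirectSum.decomposeLinearEquiv (homogeneousSubmodule σ k)).toLinearMap

theorem quotientDecomposeAux_apply (I : HomogeneousIdeal (homogeneousSubmodule σ k))
    (f : MvPolynomial σ k) (d : ℕ) :
    (quotientDecomposeAux I f d : MvPolynomial σ k ⧸ I.toIdeal) =
      Ideal.Quotient.mk I.toIdeal (DirectSum.decompose (homogeneousSubmodule σ k) f d) := by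
  simp only [quotientDecomposeAux, LinearMap.comp_apply, LinearEquiv.coe_coe,
    DirectSum.lmap_apply]
  rfl

theorem quotientDecomposeAux_of_mem (I : HomogeneousIdeal (homogeneousSubmodule σ k)) {d : ℕ}
    {f : MvPolynomial σ k} (hf : f ∈ homogeneousSubmodule σ k d) :
    quotientDecomposeAux I f =
      DirectSum.lof k ℕ (fun d => quotientGrading I d) d
        ⟨Ideal.Quotient.mk I.toIdeal f, f, hf, rfl⟩ := by
  simp only [quotientDecomposeAux, LinearMap.comp_apply, LinearEquiv.coe_coe,
    DirectSum.decomposeLinearEquiv_apply]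
  rw [DirectSum.decompose_of_mem _ hf]
  exact DirectSum.lmap_lof _ _ _

theorem quotientDecomposeAux_eq_zero (I : HomogeneousIdeal (homogeneousSubmodule σ k))
    {f : MvPolynomial σ k} (hf : f ∈ I.toIdeal) : quotientDecomposeAux I f = 0 := by
  refine DFinsupp.ext fun d => Subtype.ext ?_
  rw [quotientDecomposeAux_apply]
  exact Ideal.Quotient.eq_zero_iff_mem.mpr (I.isHomogeneous d hf)

theorem coe_quotientDecomposeAux (I : HomogeneousIdeal (homogeneousSubmodule σ k))
    (f : MvPolynomial σ k) :
    DirectSum.coeLinearMap (quotientGrading I) (quotientDecomposeAux I f) =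
      Ideal.Quotient.mk I.toIdeal f := by
  induction f using DirectSum.Decomposition.inductionOn (homogeneousSubmodule σ k) with
  | zero => simp
  | @homogeneous i m =>
    rw [quotientDecomposeAux_of_mem I m.2, DirectSum.coeLinearMap_lof]
  | add m m' h h' => rw [map_add, map_add, map_add, h, h']

/-- The map sending a class mod `I` to the family of its homogeneous parts. -/
def quotientDecompose (I : HomogeneousIdeal (homogeneousSubmodule σ k)) :
    MvPolynomial σ k ⧸ I.toIdeal →+ DirectSum ℕ fun d => quotientGrading I d :=
  QuotientAddGroup.lift I.toIdeal.toAddSubgroup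
    (quotientDecomposeAux I).toAddMonoidHom fun _ hf => quotientDecomposeAux_eq_zero I hf

theorem quotientDecompose_mk (I : HomogeneousIdeal (homogeneousSubmodule σ k))
    (f : MvPolynomial σ k) :
    quotientDecompose I (Ideal.Quotient.mk I.toIdeal f) = quotientDecomposeAux I f :=
  rfl

/-- The quotient of a polynomial ring by a homogeneous ideal, with its induced grading. -/
instance quotientGrading_gradedAlgebra (I : HomogeneousIdeal (homogeneousSubmodule σ k)) :
    GradedAlgebra (quotientGrading I) where
  decompose' := quotientDecompose I
  left_inv x := by
    obtain ⟨f, rfl⟩ := Ideal.Quotient.mk_surjective x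
    rw [quotientDecompose_mk]
    exact coe_quotientDecomposeAux I f
  right_inv x := by
    induction x using DirectSum.induction_on with
    | zero => rw [map_zero, map_zero]
    | of d y =>
      obtain ⟨_, f, hf, rfl⟩ := y
      rw [DirectSum.coeAddMonoidHom_of]
      exact quotientDecomposeAux_of_mem I hf
    | add x y hx hy => rw [map_add, map_add, hx, hy]

/-- The closed subscheme `V(I)` of projective space defined by a homogeneous ideal `I`, namely
`Proj (k[x] / I)`, as a scheme over `Spec k`. -/
def projScheme (I : HomogeneousIdeal (homogeneousSubmodule σ k)) :
    Over (Spec (CommRingCat.of k)) :=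
  Over.mk (Proj.toSpecZero (quotientGrading I) ≫
    Spec.map (CommRingCat.ofHom (algebraMap k (quotientGrading I 0))))

end Proj

/-! ### Extremal hypersurfaces and their hyperplane sections -/

section Hypersurface

variable {k : Type u} [Field k]

/-- A Frobenius form: a form of degree `q + 1` in the ideal generated by the `q`-th powers of the
variables, where `q = p ^ e`. The projective hypersurface it defines is an extremal
hypersurface. -/
def IsFrobeniusForm (p e : ℕ) {m : ℕ} (f : MvPolynomial (Fin m) k) : Prop :=
  f.IsHomogeneous (p ^ e + 1) ∧
    f ∈ Ideal.span (Set.range fun i : Fin m => (X i : MvPolynomial (Fin m) k) ^ p ^ e)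

/-- Smoothness, over an algebraically closed field, of the closed subscheme of projective space
defined by `c` forms `F 0, …, F (c - 1)`, as a subscheme of codimension `c`: at each of its points
the gradients of the `F i` are linearly independent. For `c = 1` this says that the projective
hypersurface `V(F 0)` is smooth. -/
def IsSmoothIntersection {m c : ℕ} (F : Fin c → MvPolynomial (Fin m) k) : Prop :=
  ∀ x : Fin m → k, x ≠ 0 → (∀ i, eval x (F i) = 0) →
    LinearIndependent k fun (i : Fin c) (j : Fin m) => eval x (pderiv j (F i))

/-- The homogeneous ideal `(f, L)` generated by a form `f` and a linear form `L`. -/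
def sectionIdeal {m d : ℕ} {f L : MvPolynomial (Fin m) k} (hf : f.IsHomogeneous d)
    (hL : L.IsHomogeneous 1) : HomogeneousIdeal (homogeneousSubmodule (Fin m) k) where
  toSubmodule := Ideal.span {f, L}
  is_homogeneous' := by
    refine Ideal.homogeneous_span _ _ ?_
    rintro g (rfl | rfl)
    · exact ⟨d, hf⟩
    · exact ⟨1, hL⟩

/-- The scheme-theoretic intersection `V(f) ∩ V(L)` of the hypersurface `V(f)` with the hyperplane
`V(L)`, as a scheme over `k`. -/
def hyperplaneSection {m d : ℕ} {f L : MvPolynomial (Fin m) k} (hf : f.IsHomogeneous d)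
    (hL : L.IsHomogeneous 1) : Over (Spec (CommRingCat.of k)) :=
  projScheme (sectionIdeal hf hL)

/-- The substitution `x_i ↦ ∑ j, M i j * x_j`, that is, the pullback of polynomials along the
linear map with matrix `M`. -/
def linearSubst {m r : ℕ} (M : Matrix (Fin m) (Fin r) k) :
    MvPolynomial (Fin m) k →ₐ[k] MvPolynomial (Fin r) k :=
  aeval fun i => ∑ j, C (M i j) * X j

/-- The matrix `M` gives a linear isomorphism from `k ^ n` onto the zero set of the linear form `L`
in `k ^ (n + 1)`, hence an isomorphism from `ℙ ^ (n - 1)` onto the hyperplane `V(L)`. -/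
def ParametrizesHyperplane {n : ℕ} (M : Matrix (Fin (n + 1)) (Fin n) k)
    (L : MvPolynomial (Fin (n + 1)) k) : Prop :=
  Function.Injective M.mulVec ∧ Set.range M.mulVec = {x | eval x L = 0}

/-- The section of `V(f)` by the hyperplane `V(L)` is projectively equivalent to the hypersurface
`V(g)` of `ℙ ^ (n - 1)`: a linear isomorphism from `ℙ ^ (n - 1)` onto `V(L)` pulls back
`V(f) ∩ V(L)` to `V(g)`. -/
def SectionProjectivelyEquivalent {n : ℕ} (f L : MvPolynomial (Fin (n + 1)) k)
    (g : MvPolynomial (Fin n) k) : Prop :=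
  ∃ M : Matrix (Fin (n + 1)) (Fin n) k, ParametrizesHyperplane M L ∧
    Ideal.span {linearSubst M f} = Ideal.span {g}

/-- The diagonal Frobenius form `∑ i, x_i ^ (p ^ e + 1)` in `n` variables. -/
def diagonalForm (k : Type u) [Field k] (p e n : ℕ) : MvPolynomial (Fin n) k :=
  ∑ i, X i ^ (p ^ e + 1)

end Hypersurface

end ExtremalHypersurface

end

/-! Membership in the ideal of `q`-th powers means `f = ∑ x_i ^ q * ℓ_i` with linear forms `ℓ_i`, so
`f(x) = h(x, x)` for a form `h` that is `q`-semilinear in the first slot and linear in the second. A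
hyperplane section is smooth only if the restriction of `h` to the hyperplane is smooth
(`IsSmoothSesq`), so everything rests on one classification, `exists_equiv_of_isSmoothSesq`: over an
algebraically closed field, smooth forms of equal dimension define equivalent functions `x ↦ h x x`.

For `e > 0`, smooth means that `h` has no left radical. Then `h(u, φ v) = h(v, u) ^ q` defines an
injective `q²`-semilinear map `φ`, whose fixed vectors span by Lang's theorem (`span_fixed_eq_top`).
On fixed vectors `h` is Hermitian over the field of `q²` elements, which yields a vector of norm one
with a two-sided orthogonal complement; induction splits off one square `x ^ (q + 1)` at a time. For
`e = 0`, `h(x, x)` is a nonsingular quadratic form and hyperbolic planes are split off instead.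

An equivalence between two hyperplanes extends to a linear automorphism of the ambient space that
carries one section ideal to the other, hence to an isomorphism of `Proj` over `k`. Unless `(p, e) =
(2, 0)`, the diagonal form is itself smooth, so it can serve as the second form in the
classification. -/

/-! ### Fixed vectors of Frobenius-semilinear maps -/

section FixedVectors

open Polynomial in
/-- The polynomials `P i` with `P 0 = a 0 X ^ Q` and `P (i + 1) = (P i) ^ Q + a (i + 1) X ^ Q`. -/
noncomputable def cyclicPoly {k : Type*} [Field k] (Q : ℕ) (a : ℕ → k) : ℕ → k[X]
  | 0 => Polynomial.C (a 0) * Polynomial.X ^ Q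
  | i + 1 => cyclicPoly Q a i ^ Q + Polynomial.C (a (i + 1)) * Polynomial.X ^ Q

open Polynomial in
theorem X_pow_dvd_cyclicPoly {k : Type*} [Field k] {Q : ℕ} (hQ : Q ≠ 0) (a : ℕ → k) (i : ℕ) :
    (Polynomial.X : k[X]) ^ Q ∣ cyclicPoly Q a i := by
  induction i with
  | zero => exact dvd_mul_left _ _
  | succ i ih => exact dvd_add (ih.trans (dvd_pow_self _ hQ)) (dvd_mul_left _ _)

-- `P i ^ Q` is divisible by `X ^ (Q * Q)`, so the coefficient of `X ^ Q` in `P (i + 1)` is exactly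
-- `a (i + 1)`; once that vanishes, so does `P i`.
open Polynomial in
theorem eq_zero_of_cyclicPoly_eq_zero {k : Type*} [Field k] {Q : ℕ} (hQ : 1 < Q) (a : ℕ → k)
    (i : ℕ) (h : cyclicPoly Q a i = 0) : ∀ j ≤ i, a j = 0 := by
  induction i with
  | zero =>
    intro j hj
    obtain rfl : j = 0 := by omega
    simpa [cyclicPoly] using h
  | succ i ih =>
    have h0 : a (i + 1) = 0 := by
      have hd : (Polynomial.X : k[X]) ^ (Q * Q) ∣ Polynomial.C (a (i + 1)) * Polynomial.X ^ Q := by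
        have h1 : (Polynomial.X : k[X]) ^ (Q * Q) ∣ cyclicPoly Q a i ^ Q := by
          rw [pow_mul]
          exact pow_dvd_pow_of_dvd (X_pow_dvd_cyclicPoly (by omega) a i) Q
        have h2 : Polynomial.C (a (i + 1)) * Polynomial.X ^ Q = - cyclicPoly Q a i ^ Q := by
          rw [eq_neg_iff_add_eq_zero, add_comm]
          exact h
        rw [h2]
        exact (dvd_neg).2 h1
      have := (Polynomial.X_pow_dvd_iff.1 hd) Q (by nlinarith)
      simpa using this
    have h1 : cyclicPoly Q a i = 0 := by
      have : cyclicPoly Q a i ^ Q = 0 := by simpa [cyclicPoly, h0] using h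
      exact pow_eq_zero_iff (by omega) |>.1 this
    intro j hj
    rcases Nat.lt_or_ge j (i + 1) with hj' | hj'
    · exact ih h1 j (by omega)
    · obtain rfl : j = i + 1 := by omega
      exact h0

open Polynomial in
/-- The system `c 0 = a 0 t ^ Q`, `c (i + 1) = (c i) ^ Q + a (i + 1) t ^ Q`, `c m = t` has a
solution with `t ≠ 0`. -/
theorem exists_cyclic_solution {k : Type*} [Field k] [IsAlgClosed k] {Q : ℕ} (hQ : 1 < Q)
    (a : ℕ → k) (m : ℕ) (ha : ∃ j ≤ m, a j ≠ 0) :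
    ∃ c : ℕ → k, c m ≠ 0 ∧ c 0 = a 0 * c m ^ Q ∧
      ∀ i, c (i + 1) = c i ^ Q + a (i + 1) * c m ^ Q := by
  obtain ⟨R, hR⟩ := X_pow_dvd_cyclicPoly (k := k) (Q := Q) (by omega) a m
  have hP : cyclicPoly Q a m ≠ 0 := by
    intro h
    obtain ⟨j, hj, hj'⟩ := ha
    exact hj' (eq_zero_of_cyclicPoly_eq_zero hQ a m h j hj)
  have hR0 : R ≠ 0 := by
    rintro rfl
    exact hP (by simpa using hR)
  -- With `P m = X ^ Q * R`, a root of `X ^ (Q - 1) * R - 1` is a nonzero `t` with `P m (t) = t`;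
  -- the `c i` are then the values `P i (t)`.
  have hdeg : (Polynomial.X ^ (Q - 1) * R - 1 : k[X]).degree ≠ 0 := by
    have h1 : 0 < (Polynomial.X ^ (Q - 1) * R : k[X]).degree := by
      rw [Polynomial.degree_mul, Polynomial.degree_X_pow, Polynomial.degree_eq_natDegree hR0]
      exact_mod_cast (by omega : 0 < Q - 1 + R.natDegree)
    rw [Polynomial.degree_sub_eq_left_of_degree_lt (by rw [Polynomial.degree_one]; exact h1)]
    exact h1.ne'
  obtain ⟨t, ht⟩ := IsAlgClosed.exists_root _ hdeg
  have ht' : t ^ (Q - 1) * R.eval t = 1 := by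
    simpa [sub_eq_zero] using ht
  have ht0 : t ≠ 0 := by
    rintro rfl
    rw [zero_pow (by omega)] at ht'
    simp at ht'
  have hm : (cyclicPoly Q a m).eval t = t := by
    rw [hR, Polynomial.eval_mul, Polynomial.eval_pow, Polynomial.eval_X]
    obtain ⟨r, rfl⟩ : ∃ r, Q = r + 1 := ⟨Q - 1, by omega⟩
    rw [pow_succ, mul_right_comm]
    simp only [Nat.add_sub_cancel] at ht'
    rw [ht', one_mul]
  refine ⟨fun i => (cyclicPoly Q a i).eval t, ?_, ?_, ?_⟩
  · simpa [hm] using ht0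
  · simp only [hm]
    simp [cyclicPoly]
  · intro i
    simp only [hm]
    simp [cyclicPoly]

variable {k : Type*} [Field k] {p : ℕ} [Fact p.Prime] [CharP k p] {s : ℕ}
  {V : Type*} [AddCommGroup V] [Module k V]

theorem exists_iterate_mem_span [FiniteDimensional k V] (φ : V → V) (w : V) :
    ∃ r, φ^[r] w ∈ Submodule.span k ((fun i => φ^[i] w) '' (Finset.range r : Set ℕ)) := by
  let S : ℕ →o Submodule k V :=
    ⟨fun r => Submodule.span k ((fun i => φ^[i] w) '' (Finset.range r : Set ℕ)), fun r r' h =>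
      Submodule.span_mono (Set.image_mono (by simpa using Set.Iio_subset_Iio h))⟩
  obtain ⟨r, hr⟩ := monotone_stabilizes_iff_noetherian.2 (inferInstance : IsNoetherian k V) S
  refine ⟨r, ?_⟩
  change _ ∈ S r
  rw [hr (r + 1) (Nat.le_succ r)]
  exact Submodule.subset_span ⟨r, by simp, rfl⟩

/-- An injective Frobenius-semilinear endomorphism of a nonzero space has a nonzero fixed
vector. -/
theorem exists_fixed_ne_zero [IsAlgClosed k] [FiniteDimensional k V] [Nontrivial V] (hs : s ≠ 0)
    (φ : V →ₛₗ[iterateFrobenius k p s] V) (hφ : Function.Injective φ) :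
    ∃ v, v ≠ 0 ∧ φ v = v := by
  classical
  have hp : p.Prime := Fact.out
  have hQ : 1 < p ^ s := Nat.one_lt_pow hs hp.one_lt
  obtain ⟨w, hw⟩ := exists_ne (0 : V)
  have hex := exists_iterate_mem_span (k := k) φ w
  have hr := Nat.find_spec hex
  have hmin := fun m => Nat.find_min hex (m := m)
  set r := Nat.find hex
  obtain ⟨m, hm⟩ : ∃ m, r = m + 1 := by
    refine Nat.exists_eq_succ_of_ne_zero fun h0 => hw ?_
    rw [h0] at hr
    simpa using hr
  rw [hm] at hr hmin
  rw [Submodule.mem_span_image_finset_iff_exists_fun] at hr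
  obtain ⟨a', ha⟩ := hr
  -- The coefficients are extended by zero to all of `ℕ`, the form that the recursion needs.
  obtain ⟨a, rfl⟩ : ∃ a : ℕ → k, a' = fun i : Finset.range (m + 1) => a i.1 :=
    ⟨fun i => if h : i ∈ Finset.range (m + 1) then a' ⟨i, h⟩ else 0, by
      funext i
      simp only [Finset.coe_mem, dite_true]⟩
  rw [Finset.sum_coe_sort (Finset.range (m + 1)) fun i => a i • φ^[i] w] at ha
  have hne : φ^[m + 1] w ≠ 0 := by
    intro h
    have : ∀ j, φ^[j] w ≠ 0 := by
      intro j
      induction j with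
      | zero => simpa using hw
      | succ j ih =>
        rw [Function.iterate_succ_apply']
        intro h'
        exact ih (hφ (h'.trans (map_zero φ).symm))
    exact this _ h
  -- Expanding `φ v = v` for `v = ∑ c i • φ^[i] w` and replacing `φ^[m + 1] w` by `∑ a i • φ^[i] w`
  -- gives exactly the cyclic system. Minimality of `m + 1` and `c m ≠ 0` ensure `v ≠ 0`.
  obtain ⟨c, hc, hc0, hcs⟩ := exists_cyclic_solution hQ a m (by
    by_contra! h
    refine hne ?_
    rw [← ha]
    exact Finset.sum_eq_zero fun i hi => by
      rw [h i (by simpa [Nat.lt_succ_iff] using hi), zero_smul])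
  refine ⟨∑ i ∈ Finset.range (m + 1), c i • φ^[i] w, ?_, ?_⟩
  · intro h
    refine hmin m (Nat.lt_succ_self m) ?_
    rw [Finset.sum_range_succ, add_comm, ← eq_neg_iff_add_eq_zero] at h
    have h' : φ^[m] w = (c m)⁻¹ • -∑ i ∈ Finset.range m, c i • φ^[i] w := by
      rw [← h, inv_smul_smul₀ hc]
    rw [h']
    exact Submodule.smul_mem _ _ (Submodule.neg_mem _ (Submodule.sum_mem _ fun i hi =>
      Submodule.smul_mem _ _ (Submodule.subset_span ⟨i, hi, rfl⟩)))
  · rw [map_sum]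
    simp only [map_smulₛₗ, iterateFrobenius_def, ← Function.iterate_succ_apply' φ]
    rw [Finset.sum_range_succ, ← ha, Finset.smul_sum, Finset.sum_range_succ',
      Finset.sum_range_succ' _ m, ← add_assoc, ← Finset.sum_add_distrib]
    congr 1
    · refine Finset.sum_congr rfl fun i _ => ?_
      rw [hcs i, add_smul, mul_comm, mul_smul]
    · rw [hc0, mul_comm, mul_smul]

/-- **Lang's theorem** for the general linear group: the fixed vectors of an injective
Frobenius-semilinear endomorphism span. -/
theorem span_fixed_eq_top [IsAlgClosed k] [FiniteDimensional k V] (hs : s ≠ 0)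
    (φ : V →ₛₗ[iterateFrobenius k p s] V) (hφ : Function.Injective φ) :
    Submodule.span k {v | φ v = v} = ⊤ := by
  have hp : p.Prime := Fact.out
  have hQ : 1 < p ^ s := Nat.one_lt_pow hs hp.one_lt
  set W := Submodule.span k {v | φ v = v} with hW
  by_contra hne
  have hle : W ≤ W.comap φ := by
    rw [hW, Submodule.span_le]
    intro v hv
    have : φ v = v := hv
    change φ v ∈ W
    rw [this]
    exact Submodule.subset_span hv
  have hsurj : ∀ x ∈ W, ∃ y ∈ W, φ y = x := by
    intro x hx
    induction hx using Submodule.closure_induction with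
    | zero => exact ⟨0, zero_mem _, map_zero φ⟩
    | add x y _ _ hx hy =>
      obtain ⟨x', hx', rfl⟩ := hx
      obtain ⟨y', hy', rfl⟩ := hy
      exact ⟨x' + y', add_mem hx' hy', map_add φ _ _⟩
    | smul_mem c v hv =>
      obtain ⟨d, hd⟩ := IsAlgClosed.exists_pow_nat_eq c (n := p ^ s) (by omega)
      refine ⟨d • v, Submodule.smul_mem _ _ (Submodule.subset_span hv), ?_⟩
      rw [map_smulₛₗ, iterateFrobenius_def, hd, hv]
  -- `φ - 1` maps `W` onto `W`: on multiples of a fixed vector this is the Artin–Schreier equation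
  -- `d ^ Q - d = c` with `Q = p ^ s`.
  have hsub : ∀ x ∈ W, ∃ y ∈ W, φ y - y = x := by
    intro x hx
    induction hx using Submodule.closure_induction with
    | zero => exact ⟨0, zero_mem _, by simp⟩
    | add x y _ _ hx hy =>
      obtain ⟨x', hx', rfl⟩ := hx
      obtain ⟨y', hy', rfl⟩ := hy
      exact ⟨x' + y', add_mem hx' hy', by rw [map_add]; abel⟩
    | smul_mem c v hv =>
      obtain ⟨d, hd⟩ : ∃ d : k, d ^ p ^ s - d = c := by
        have hdeg : (Polynomial.X ^ p ^ s - (Polynomial.X + Polynomial.C c)).degree ≠ 0 := by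
          rw [Polynomial.degree_sub_eq_left_of_degree_lt]
          · rw [Polynomial.degree_X_pow]
            exact_mod_cast (by omega : p ^ s ≠ 0)
          · rw [Polynomial.degree_X_add_C, Polynomial.degree_X_pow]
            exact_mod_cast hQ
        obtain ⟨d, hd⟩ := IsAlgClosed.exists_root _ hdeg
        refine ⟨d, ?_⟩
        simp only [Polynomial.IsRoot.def, Polynomial.eval_sub, Polynomial.eval_pow,
          Polynomial.eval_X, Polynomial.eval_add, Polynomial.eval_C] at hd
        linear_combination hd
      refine ⟨d • v, Submodule.smul_mem _ _ (Submodule.subset_span hv), ?_⟩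
      rw [map_smulₛₗ, iterateFrobenius_def, hv, ← sub_smul, hd]
  have : Nontrivial (V ⧸ W) := Submodule.Quotient.nontrivial_iff.2 hne
  -- Since `φ` maps `W` onto itself and is injective, `φ v ∈ W` forces `v ∈ W`. A nonzero fixed
  -- class in the quotient can thus be found, and `hsub` corrects it to a fixed vector outside `W`.
  have hinj : Function.Injective (W.mapQ W φ hle) := by
    rw [injective_iff_map_eq_zero]
    intro x hx
    obtain ⟨v, rfl⟩ := W.mkQ_surjective x
    rw [Submodule.mkQ_apply] at hx ⊢
    rw [Submodule.mapQ_apply, Submodule.Quotient.mk_eq_zero] at hx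
    obtain ⟨y, hy, hyv⟩ := hsurj _ hx
    rw [Submodule.Quotient.mk_eq_zero]
    exact hφ hyv ▸ hy
  obtain ⟨x, hx0, hx⟩ := exists_fixed_ne_zero hs _ hinj
  obtain ⟨v, rfl⟩ := W.mkQ_surjective x
  rw [Submodule.mkQ_apply, Ne, Submodule.Quotient.mk_eq_zero] at hx0
  rw [Submodule.mkQ_apply, Submodule.mapQ_apply, Submodule.Quotient.eq] at hx
  obtain ⟨y, hy, hyv⟩ := hsub _ hx
  refine hx0 ?_
  have : v - y ∈ W := Submodule.subset_span (by
    change φ (v - y) = v - y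
    rw [map_sub]
    rw [sub_eq_sub_iff_sub_eq_sub]
    exact hyv.symm)
  simpa using add_mem this hy

end FixedVectors

/-! ### Frobenius-sesquilinear forms -/

section Sesquilinear

variable {k : Type*} [Field k] {p : ℕ} [Fact p.Prime] [CharP k p] {e : ℕ}
  {V : Type*} [AddCommGroup V] [Module k V] {V' : Type*} [AddCommGroup V'] [Module k V']

/-- The derivative at `x` in the direction `y` of the function `x ↦ h x x`. -/
def sesqDeriv (h : V →ₛₗ[iterateFrobenius k p e] V →ₗ[k] k) (x y : V) : k :=
  h x y + if e = 0 then h y x else 0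

/-- Smoothness of the projective hypersurface defined by `x ↦ h x x`. -/
def IsSmoothSesq (h : V →ₛₗ[iterateFrobenius k p e] V →ₗ[k] k) : Prop :=
  ∀ x, h x x = 0 → (∀ y, sesqDeriv h x y = 0) → x = 0

/-- The restriction of a sesquilinear form to a subspace. -/
def sesqRestrict (h : V →ₛₗ[iterateFrobenius k p e] V →ₗ[k] k) (U : Submodule k V) :
    U →ₛₗ[iterateFrobenius k p e] U →ₗ[k] k :=
  LinearMap.mk₂'ₛₗ _ _ (fun x y => h x y) (by simp) (by simp [map_smulₛₗ]) (by simp) (by simp)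

@[simp]
theorem sesqRestrict_apply (h : V →ₛₗ[iterateFrobenius k p e] V →ₗ[k] k) (U : Submodule k V)
    (x y : U) : sesqRestrict h U x y = h x y :=
  rfl

theorem sesq_smul_left (h : V →ₛₗ[iterateFrobenius k p e] V →ₗ[k] k) (c : k) (x y : V) :
    h (c • x) y = c ^ p ^ e * h x y := by
  rw [map_smulₛₗ, LinearMap.smul_apply, iterateFrobenius_def, smul_eq_mul]

theorem sesq_sum_left {ι : Type*} (s : Finset ι) (h : V →ₛₗ[iterateFrobenius k p e] V →ₗ[k] k)
    (c : ι → k) (b : ι → V) (y : V) :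
    h (∑ i ∈ s, c i • b i) y = ∑ i ∈ s, c i ^ p ^ e * h (b i) y := by
  simp only [map_sum, LinearMap.sum_apply, sesq_smul_left]

/-! ### Positive exponent: Hermitian vectors and splitting off a unit vector. -/

theorem isSmoothSesq_iff_of_ne_zero (he : e ≠ 0)
    (h : V →ₛₗ[iterateFrobenius k p e] V →ₗ[k] k) :
    IsSmoothSesq h ↔ ∀ x, (∀ y, h x y = 0) → x = 0 := by
  simp only [IsSmoothSesq, sesqDeriv, if_neg he, add_zero]
  -- `h x x = 0` is the case `y = x` of the vanishing of the derivative.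
  exact ⟨fun H x hx => H x (hx x) hx, fun H x _ hx => H x hx⟩

/-- Nondegeneracy lets one solve for `φ v` on a basis; both sides are `q`-semilinear in `u`, so the
basis suffices. The fixed vectors of `φ` are those `v` with `h u v = h v u ^ q` for all `u`. -/
theorem exists_conj_map [IsAlgClosed k] [FiniteDimensional k V]
    (h : V →ₛₗ[iterateFrobenius k p e] V →ₗ[k] k) (hh : ∀ x, (∀ y, h x y = 0) → x = 0) :
    ∃ φ : V →ₛₗ[iterateFrobenius k p (e + e)] V, Function.Injective φ ∧
      ∀ u v, h u (φ v) = h v u ^ p ^ e := by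
  classical
  have hp : p.Prime := Fact.out
  have hq : 0 < p ^ e := pow_pos hp.pos e
  have : ExpChar k p := ExpChar.prime hp
  let b := Module.finBasis k V
  let θ : V →ₗ[k] (Fin (Module.finrank k V) → k) := LinearMap.pi fun i => h (b i)
  have hsurj : Function.Surjective θ := by
    rw [← LinearMap.range_eq_top]
    by_contra hne
    obtain ⟨f, hf, hle⟩ := Submodule.exists_le_ker_of_lt_top _ (lt_top_iff_ne_top.2 hne)
    -- A functional killing the range of `θ` gives, through `q`-th roots of its coefficients, a
    -- vector in the left radical.
    have hroot : ∀ i, ∃ d : k, d ^ p ^ e = f (Pi.single i 1) := fun i =>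
      IsAlgClosed.exists_pow_nat_eq _ hq
    choose d hd using hroot
    have hz : ∑ i, d i • b i = 0 := by
      refine hh _ fun w => ?_
      rw [sesq_sum_left]
      have hw : f (θ w) = 0 := hle ⟨w, rfl⟩
      rw [LinearMap.pi_apply_eq_sum_univ f (θ w)] at hw
      rw [← hw]
      refine Finset.sum_congr rfl fun i _ => ?_
      rw [hd, smul_eq_mul, mul_comm]
      congr 2
      funext j
      simp [Pi.single_apply, eq_comm]
    have hd0 := Fintype.linearIndependent_iff.1 b.linearIndependent d hz
    refine hf (LinearMap.pi_ext' fun i => LinearMap.ext_ring ?_)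
    rw [LinearMap.comp_apply, LinearMap.coe_single, ← hd, hd0, zero_pow hq.ne']
    simp
  have hinj : Function.Injective θ :=
    (LinearMap.injective_iff_surjective_of_finrank_eq_finrank (by simp)).2 hsurj
  let Θ := LinearEquiv.ofBijective θ ⟨hinj, hsurj⟩
  let φ : V →ₛₗ[iterateFrobenius k p (e + e)] V :=
    { toFun := fun v => Θ.symm fun i => h v (b i) ^ p ^ e
      map_add' := fun x y => by
        rw [← map_add]
        congr 1
        funext i
        simp [add_pow_expChar_pow]
      map_smul' := fun c x => by
        rw [← map_smul]
        congr 1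
        funext i
        simp [iterateFrobenius_def, mul_pow, pow_add, pow_mul] }
  have hφ : ∀ u v, h u (φ v) = h v u ^ p ^ e := by
    intro u v
    have hb : ∀ i, h (b i) (φ v) = h v (b i) ^ p ^ e := fun i =>
      congrFun (Θ.apply_symm_apply fun i => h v (b i) ^ p ^ e) i
    rw [← b.sum_repr u, sesq_sum_left]
    simp only [hb, map_sum, map_smul, smul_eq_mul, sum_pow_char_pow, mul_pow]
  refine ⟨φ, (injective_iff_map_eq_zero φ).2 fun x hx => hh x fun y => ?_, hφ⟩
  have := hφ y x
  rw [hx, map_zero] at this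
  exact (pow_eq_zero_iff hq.ne').1 this.symm

/-- A nondegenerate sesquilinear form has a vector `v` of norm one whose left and right
orthogonal complements agree. -/
theorem exists_unit_vector [IsAlgClosed k] [FiniteDimensional k V] [Nontrivial V] (he : e ≠ 0)
    (h : V →ₛₗ[iterateFrobenius k p e] V →ₗ[k] k) (hh : ∀ x, (∀ y, h x y = 0) → x = 0) :
    ∃ v, h v v = 1 ∧ ∀ u, h u v = h v u ^ p ^ e := by
  have hp : p.Prime := Fact.out
  have hq : 1 < p ^ e := Nat.one_lt_pow he hp.one_lt
  have : ExpChar k p := ExpChar.prime hp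
  obtain ⟨φ, hinj, hφ⟩ := exists_conj_map h hh
  have hspan := span_fixed_eq_top (by omega) φ hinj
  have hsym : ∀ v, φ v = v → ∀ u, h u v = h v u ^ p ^ e := fun v hv u => by
    rw [← hφ, hv]
  have hsmul : ∀ (c : k) v, (c ^ p ^ e) ^ p ^ e = c → φ v = v → φ (c • v) = c • v := by
    intro c v hc hv
    rw [map_smulₛₗ, hv, iterateFrobenius_def, pow_add, pow_mul, hc]
  obtain ⟨v, hv, hvv⟩ : ∃ v, φ v = v ∧ h v v ≠ 0 := by
    by_contra! H
    obtain ⟨x, hx0⟩ := exists_ne (0 : V)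
    have hpair : ∃ v, φ v = v ∧ ∃ u, φ u = u ∧ h v u ≠ 0 := by
      by_contra! H'
      have h1 : ∀ v, φ v = v → ∀ u, h v u = 0 := by
        intro v hv u
        have hu : u ∈ Submodule.span k {v | φ v = v} := hspan ▸ Submodule.mem_top
        have hle : Submodule.span k {v | φ v = v} ≤ LinearMap.ker (h v) :=
          Submodule.span_le.2 fun u hu => H' v hv u hu
        exact hle hu
      have h2 : Submodule.span k {v | φ v = v} ≤ ⊥ :=
        Submodule.span_le.2 fun v hv => hh v (h1 v hv)
      rw [hspan] at h2
      exact hx0 ((Submodule.mem_bot k).1 (h2 Submodule.mem_top))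
    obtain ⟨v, hv, u, hu, huv⟩ := hpair
    have ha : (h v u ^ p ^ e) ^ p ^ e = h v u := by
      rw [← hsym v hv u, ← hsym u hu v]
    -- If all fixed vectors are isotropic, `v + (d / h v u) • u` has norm `d + d ^ q = 1`. It is
    -- still fixed, because `d` and `h v u` both satisfy `x ^ (q²) = x`.
    obtain ⟨d, hd⟩ : ∃ d : k, d ^ p ^ e + d = 1 := by
      have hdeg : (Polynomial.X ^ p ^ e - (-Polynomial.X + Polynomial.C (1 : k))).degree ≠ 0 := by
        have h1 : (-Polynomial.X + Polynomial.C (1 : k)).degree < ((p ^ e : ℕ) : WithBot ℕ) := by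
          refine lt_of_le_of_lt (Polynomial.degree_add_le _ _) (max_lt ?_ ?_)
          · rw [Polynomial.degree_neg, Polynomial.degree_X]
            exact_mod_cast hq
          · exact lt_of_le_of_lt Polynomial.degree_C_le (by exact_mod_cast (by omega : 0 < p ^ e))
        rw [Polynomial.degree_sub_eq_left_of_degree_lt (by rwa [Polynomial.degree_X_pow]),
          Polynomial.degree_X_pow]
        exact_mod_cast (by omega : p ^ e ≠ 0)
      obtain ⟨d, hd⟩ := IsAlgClosed.exists_root _ hdeg
      refine ⟨d, ?_⟩
      simp only [Polynomial.IsRoot.def, Polynomial.eval_sub, Polynomial.eval_pow,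
        Polynomial.eval_X, Polynomial.eval_add, Polynomial.eval_neg, Polynomial.eval_C] at hd
      linear_combination hd
    have hd2 : (d ^ p ^ e) ^ p ^ e = d := by
      have h1 : d ^ p ^ e = 1 - d := by linear_combination hd
      rw [h1, sub_pow_expChar_pow, one_pow, h1]
      ring
    have hc : ((d / h v u) ^ p ^ e) ^ p ^ e = d / h v u := by
      rw [div_pow, div_pow, hd2, ha]
    have hcu := hsmul _ u hc hu
    have hsum := H (v + (d / h v u) • u) (by rw [map_add, hv, hcu])
    rw [map_add, map_add, LinearMap.add_apply, LinearMap.add_apply, H v hv, H _ hcu,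
      hsym v hv ((d / h v u) • u), map_smul, smul_eq_mul, div_mul_cancel₀ _ huv, zero_add,
      add_zero, hd] at hsum
    exact one_ne_zero hsum
  -- Rescaling to norm one preserves fixedness: `(h v v) ^ q = h v v`, so `c ^ (q + 1)` is invariant
  -- under `x ↦ x ^ q`, which gives `c ^ (q²) = c`.
  obtain ⟨c, hc⟩ := IsAlgClosed.exists_pow_nat_eq (h v v)⁻¹ (n := p ^ e + 1) (by omega)
  have hc0 : c ≠ 0 := by
    rintro rfl
    rw [zero_pow (by omega)] at hc
    exact inv_ne_zero hvv hc.symm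
  have hc2 : (c ^ p ^ e) ^ p ^ e = c := by
    have h1 : (c ^ (p ^ e + 1)) ^ p ^ e = c ^ (p ^ e + 1) := by
      rw [hc, inv_pow, ← hsym v hv v]
    rw [pow_succ, mul_pow, mul_comm] at h1
    exact mul_left_cancel₀ (pow_ne_zero _ hc0) h1
  refine ⟨c • v, ?_, hsym _ (hsmul c v hc2 hv)⟩
  rw [sesq_smul_left, map_smul, smul_eq_mul, ← mul_assoc, ← pow_succ, hc, inv_mul_cancel₀ hvv]

/-- The kernel of `h v` is orthogonal to `v` on both sides, so there are no cross terms and the left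
radical of the restriction lies in that of `h`. -/
theorem exists_split_unit [IsAlgClosed k] [FiniteDimensional k V] [Nontrivial V] (he : e ≠ 0)
    (h : V →ₛₗ[iterateFrobenius k p e] V →ₗ[k] k) (hh : IsSmoothSesq h) :
    ∃ U : Submodule k V, IsSmoothSesq (sesqRestrict h U) ∧ ∃ E : (k × U) ≃ₗ[k] V,
      ∀ x, h (E x) (E x) = x.1 ^ (p ^ e + 1) + h x.2 x.2 := by
  have hp : p.Prime := Fact.out
  have hq : 0 < p ^ e := pow_pos hp.pos e
  rw [isSmoothSesq_iff_of_ne_zero he] at hh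
  obtain ⟨v, hv, hsym⟩ := exists_unit_vector he h hh
  have hU : ∀ u : LinearMap.ker (h v), h v u = 0 := fun u => u.2
  have hU' : ∀ u : LinearMap.ker (h v), h u v = 0 := fun u => by
    rw [hsym, hU, zero_pow hq.ne']
  have hdec : ∀ x, x - h v x • v ∈ LinearMap.ker (h v) := fun x => by
    rw [LinearMap.mem_ker, map_sub, map_smul, hv, smul_eq_mul, mul_one, sub_self]
  refine ⟨LinearMap.ker (h v), ?_, ?_⟩
  · rw [isSmoothSesq_iff_of_ne_zero he]
    intro x hx
    refine Subtype.ext (hh x fun y => ?_)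
    have h1 : h x (y - h v y • v) = 0 := hx ⟨_, hdec y⟩
    rwa [map_sub, map_smul, hU', smul_zero, sub_zero] at h1
  · let F : (k × LinearMap.ker (h v)) →ₗ[k] V :=
      (LinearMap.toSpanSingleton k V v).coprod (LinearMap.ker (h v)).subtype
    have hF : ∀ x, F x = x.1 • v + x.2 := fun x => by simp [F]
    have hbij : Function.Bijective F := by
      refine ⟨(injective_iff_map_eq_zero F).2 fun x hx => ?_, fun x =>
        ⟨(h v x, ⟨_, hdec x⟩), by rw [hF]; simp⟩⟩
      rw [hF] at hx
      have h1 : x.1 = 0 := by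
        have := congrArg (h v) hx
        rwa [map_add, map_smul, hv, hU, map_zero, add_zero, smul_eq_mul, mul_one] at this
      rw [h1, zero_smul, zero_add] at hx
      exact Prod.ext h1 (Subtype.ext hx)
    refine ⟨LinearEquiv.ofBijective F hbij, fun x => ?_⟩
    rw [LinearEquiv.ofBijective_apply, hF, map_add, map_add, LinearMap.add_apply, LinearMap.add_apply,
      sesq_smul_left, sesq_smul_left, hU, map_smul, map_smul, hU', hv]
    simp [pow_succ]

theorem exists_equiv_of_ne_zero [IsAlgClosed k] (he : e ≠ 0) (n : ℕ) :
    ∀ {V : Type*} {V' : Type*} [AddCommGroup V] [Module k V] [AddCommGroup V'] [Module k V']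
      [FiniteDimensional k V] [FiniteDimensional k V'],
      Module.finrank k V = n → Module.finrank k V' = n →
      ∀ (h : V →ₛₗ[iterateFrobenius k p e] V →ₗ[k] k)
        (h' : V' →ₛₗ[iterateFrobenius k p e] V' →ₗ[k] k), IsSmoothSesq h → IsSmoothSesq h' →
      ∃ P : V ≃ₗ[k] V', ∀ x, h' (P x) (P x) = h x x := by
  induction n with
  | zero =>
    intro V V' _ _ _ _ _ _ hV hV' h h' _ _
    have := Module.finrank_zero_iff.1 hV
    exact ⟨LinearEquiv.ofFinrankEq V V' (hV.trans hV'.symm), fun x => by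
      simp [Subsingleton.elim x 0]⟩
  | succ n ih =>
    intro V V' _ _ _ _ _ _ hV hV' h h' hh hh'
    have := Module.nontrivial_of_finrank_pos (R := k) (M := V) (by omega)
    have := Module.nontrivial_of_finrank_pos (R := k) (M := V') (by omega)
    obtain ⟨U, hU, E, hE⟩ := exists_split_unit he h hh
    obtain ⟨U', hU', E', hE'⟩ := exists_split_unit he h' hh'
    have hf := E.finrank_eq
    have hf' := E'.finrank_eq
    rw [Module.finrank_prod, Module.finrank_self] at hf hf'
    obtain ⟨P, hP⟩ := ih (V := U) (V' := U') (by omega) (by omega) _ _ hU hU'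
    refine ⟨E.symm.trans (((LinearEquiv.refl k k).prodCongr P).trans E'), fun x => ?_⟩
    obtain ⟨y, rfl⟩ := E.surjective x
    simp only [sesqRestrict_apply] at hP
    simp [hE, hE', hP]

/-! ### Exponent zero: quadratic forms and hyperbolic planes. -/

theorem exists_isotropic [IsAlgClosed k] [FiniteDimensional k V] (hV : 1 < Module.finrank k V)
    (h : V →ₛₗ[iterateFrobenius k p 0] V →ₗ[k] k) : ∃ v, v ≠ 0 ∧ h v v = 0 := by
  have := Module.nontrivial_of_finrank_pos (R := k) (M := V) (by omega)
  obtain ⟨y, hy⟩ := exists_ne (0 : V)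
  obtain ⟨x, hx⟩ := exists_linearIndependent_pair_of_one_lt_finrank hV hy
  by_cases hyy : h y y = 0
  · exact ⟨y, hy, hyy⟩
  -- This is `h (x + t • y) (x + t • y)` as a polynomial in `t`.
  have hdeg : (Polynomial.C (h y y) * Polynomial.X ^ 2 +
      Polynomial.C (h x y + h y x) * Polynomial.X + Polynomial.C (h x x)).degree ≠ 0 := by
    rw [Polynomial.degree_quadratic hyy]
    decide
  obtain ⟨t, ht⟩ := IsAlgClosed.exists_root _ hdeg
  refine ⟨x + t • y, fun h0 => ?_, ?_⟩
  · have := LinearIndependent.pair_iff.1 hx t 1 (by rw [one_smul, add_comm, h0])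
    exact one_ne_zero this.2
  · simp only [map_add, LinearMap.add_apply, sesq_smul_left, map_smul, smul_eq_mul, pow_zero,
      pow_one]
    simp at ht
    linear_combination ht

/-- `U` is the orthogonal complement, for the polar form `B`, of a hyperbolic pair `v, w`. The
quadratic form is never recovered from `B`, so characteristic 2 needs no separate treatment. -/
theorem exists_split_hyperbolic [IsAlgClosed k] [FiniteDimensional k V]
    (hV : 1 < Module.finrank k V) (h : V →ₛₗ[iterateFrobenius k p 0] V →ₗ[k] k)
    (hh : IsSmoothSesq h) :
    ∃ U : Submodule k V, IsSmoothSesq (sesqRestrict h U) ∧ ∃ E : ((k × k) × U) ≃ₗ[k] V,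
      ∀ x, h (E x) (E x) = x.1.1 * x.1.2 + h x.2 x.2 := by
  have hsl : ∀ (c : k) x y, h (c • x) y = c * h x y := fun c x y => by
    rw [sesq_smul_left, pow_zero, pow_one]
  let B : V → V →ₗ[k] k := fun v =>
    { toFun := fun x => h v x + h x v
      map_add' := fun x y => by simp only [map_add, LinearMap.add_apply]; ring
      map_smul' := fun c x => by
        simp only [map_smul, hsl, smul_eq_mul, RingHom.id_apply]
        ring }
  have hB : ∀ v x, B v x = h v x + h x v := fun _ _ => rfl
  have hBs : ∀ v x, B v x = B x v := fun _ _ => add_comm _ _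
  have hsmooth : ∀ x, h x x = 0 → (∀ y, B x y = 0) → x = 0 := fun x h1 h2 =>
    hh x h1 fun y => by
      rw [sesqDeriv, if_pos rfl]
      exact h2 y
  obtain ⟨v, hv0, hv⟩ := exists_isotropic hV h
  have hBv : B v v = 0 := by rw [hB, hv, add_zero]
  obtain ⟨w₀, hw₀⟩ : ∃ w, B v w ≠ 0 := by
    by_contra! H
    exact hv0 (hsmooth v hv H)
  obtain ⟨w₁, hw₁⟩ : ∃ w, B v w = 1 := ⟨(B v w₀)⁻¹ • w₀, by
    rw [map_smul, smul_eq_mul, inv_mul_cancel₀ hw₀]⟩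
  -- Subtracting `h w₁ w₁ • v` changes the norm of `w₁` by `-h w₁ w₁ * B v w₁`, which makes it zero.
  obtain ⟨w, hvw, hw⟩ : ∃ w, B v w = 1 ∧ h w w = 0 := by
    refine ⟨w₁ - h w₁ w₁ • v, by rw [map_sub, map_smul, hBv, hw₁, smul_zero, sub_zero], ?_⟩
    rw [hB] at hw₁
    simp only [map_sub, LinearMap.sub_apply, hsl, map_smul, hv, smul_eq_mul]
    linear_combination (-(h w₁ w₁)) * hw₁
  have hBw : B w w = 0 := by rw [hB, hw, add_zero]
  have hwv : B w v = 1 := by rw [hBs, hvw]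
  let U := LinearMap.ker (B v) ⊓ LinearMap.ker (B w)
  have hUv : ∀ u : U, B v u = 0 := fun u => u.2.1
  have hUw : ∀ u : U, B w u = 0 := fun u => u.2.2
  have hdec : ∀ x, x - B w x • v - B v x • w ∈ U := fun x => by
    constructor
    · simp [hBv, hvw]
    · simp [hBw, hwv]
  refine ⟨U, fun x hx hx' => Subtype.ext (hsmooth x hx fun y => ?_), ?_⟩
  · have h1 : B x (y - B w y • v - B v y • w) = 0 := by
      have := hx' ⟨_, hdec y⟩
      rw [sesqDeriv, if_pos rfl] at this
      exact this
    rwa [map_sub, map_sub, map_smul, map_smul, hBs _ v, hBs _ w, hUv, hUw, smul_zero, smul_zero,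
      sub_zero, sub_zero] at h1
  · let F : ((k × k) × U) →ₗ[k] V :=
      ((LinearMap.toSpanSingleton k V v).coprod (LinearMap.toSpanSingleton k V w)).coprod U.subtype
    have hF : ∀ x, F x = x.1.1 • v + x.1.2 • w + x.2 := fun x => by simp [F]
    have hbij : Function.Bijective F := by
      refine ⟨(injective_iff_map_eq_zero F).2 fun x hx => ?_, fun x =>
        ⟨((B w x, B v x), ⟨_, hdec x⟩), by rw [hF]; simp⟩⟩
      rw [hF] at hx
      have h1 : x.1.1 = 0 := by
        have := congrArg (B w) hx
        simpa [hwv, hBw, hUw] using this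
      have h2 : x.1.2 = 0 := by
        have := congrArg (B v) hx
        simpa [hvw, hBv, hUv] using this
      rw [h1, h2, zero_smul, zero_smul, zero_add, zero_add] at hx
      exact Prod.ext (Prod.ext h1 h2) (Subtype.ext hx)
    refine ⟨LinearEquiv.ofBijective F hbij, fun x => ?_⟩
    have h1 := hUv x.2
    have h2 := hUw x.2
    rw [hB] at h1 h2 hvw
    rw [LinearEquiv.ofBijective_apply, hF]
    simp only [map_add, LinearMap.add_apply, hsl, map_smul, smul_eq_mul, hv, hw]
    linear_combination x.1.1 * h1 + x.1.2 * h2 + x.1.1 * x.1.2 * hvw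

/-- The clause `h x x = 0` in `IsSmoothSesq` matters here: for `p = 2` and `e = 0` the derivative
vanishes identically on a line, yet a nonzero form on it is smooth. -/
theorem sesq_line (g : V →ₛₗ[iterateFrobenius k p e] V →ₗ[k] k) (E : k ≃ₗ[k] V)
    (hg : IsSmoothSesq g) :
    g (E 1) (E 1) ≠ 0 ∧ ∀ c, g (E c) (E c) = c ^ (p ^ e + 1) * g (E 1) (E 1) := by
  have hc : ∀ c, E c = c • E 1 := fun c => by rw [← map_smul, smul_eq_mul, mul_one]
  refine ⟨fun h0 => ?_, fun c => ?_⟩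
  · have : E 1 = 0 := by
      refine hg _ h0 fun y => ?_
      obtain ⟨c, rfl⟩ := E.surjective y
      rw [hc c, sesqDeriv, (g (E 1)).map_smul, sesq_smul_left, h0]
      simp
    rw [map_eq_zero_iff E E.injective] at this
    exact one_ne_zero this
  · rw [hc c, sesq_smul_left, map_smul, smul_eq_mul]
    ring

theorem exists_equiv_of_finrank_eq_one [IsAlgClosed k] [FiniteDimensional k V]
    [FiniteDimensional k V'] (hV : Module.finrank k V = 1) (hV' : Module.finrank k V' = 1)
    (h : V →ₛₗ[iterateFrobenius k p e] V →ₗ[k] k)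
    (h' : V' →ₛₗ[iterateFrobenius k p e] V' →ₗ[k] k) (hh : IsSmoothSesq h)
    (hh' : IsSmoothSesq h') : ∃ P : V ≃ₗ[k] V', ∀ x, h' (P x) (P x) = h x x := by
  let E := LinearEquiv.ofFinrankEq k V (by rw [hV, Module.finrank_self])
  let E' := LinearEquiv.ofFinrankEq k V' (by rw [hV', Module.finrank_self])
  obtain ⟨ha, hE⟩ := sesq_line h E hh
  obtain ⟨ha', hE'⟩ := sesq_line h' E' hh'
  obtain ⟨d, hd⟩ := IsAlgClosed.exists_pow_nat_eq (h (E 1) (E 1) / h' (E' 1) (E' 1))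
    (n := p ^ e + 1) (by omega)
  have hd0 : d ≠ 0 := by
    rintro rfl
    rw [zero_pow (by omega)] at hd
    exact div_ne_zero ha ha' hd.symm
  refine ⟨E.symm.trans ((LinearEquiv.smulOfNeZero k k d hd0).trans E'), fun x => ?_⟩
  obtain ⟨c, rfl⟩ := E.surjective x
  simp only [LinearEquiv.trans_apply, LinearEquiv.symm_apply_apply]
  rw [LinearEquiv.smulOfNeZero_apply, hE', hE, smul_eq_mul, mul_pow, hd]
  field_simp

theorem exists_equiv_of_eq_zero [IsAlgClosed k] (n : ℕ) :
    ∀ {V : Type*} {V' : Type*} [AddCommGroup V] [Module k V] [AddCommGroup V'] [Module k V']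
      [FiniteDimensional k V] [FiniteDimensional k V'],
      Module.finrank k V = n → Module.finrank k V' = n →
      ∀ (h : V →ₛₗ[iterateFrobenius k p 0] V →ₗ[k] k)
        (h' : V' →ₛₗ[iterateFrobenius k p 0] V' →ₗ[k] k), IsSmoothSesq h → IsSmoothSesq h' →
      ∃ P : V ≃ₗ[k] V', ∀ x, h' (P x) (P x) = h x x := by
  induction n using Nat.twoStepInduction with
  | zero =>
    intro V V' _ _ _ _ _ _ hV hV' h h' _ _
    have := Module.finrank_zero_iff.1 hV
    exact ⟨LinearEquiv.ofFinrankEq V V' (hV.trans hV'.symm), fun x => by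
      simp [Subsingleton.elim x 0]⟩
  | one =>
    intro V V' _ _ _ _ _ _ hV hV' h h' hh hh'
    exact exists_equiv_of_finrank_eq_one hV hV' h h' hh hh'
  | more n ih _ =>
    intro V V' _ _ _ _ _ _ hV hV' h h' hh hh'
    obtain ⟨U, hU, E, hE⟩ := exists_split_hyperbolic (by omega) h hh
    obtain ⟨U', hU', E', hE'⟩ := exists_split_hyperbolic (by omega) h' hh'
    have hf := E.finrank_eq
    have hf' := E'.finrank_eq
    rw [Module.finrank_prod, Module.finrank_prod, Module.finrank_self] at hf hf'
    obtain ⟨P, hP⟩ := ih (V := U) (V' := U') (by omega) (by omega) _ _ hU hU'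
    refine ⟨E.symm.trans (((LinearEquiv.refl k (k × k)).prodCongr P).trans E'), fun x => ?_⟩
    obtain ⟨y, rfl⟩ := E.surjective x
    simp only [sesqRestrict_apply] at hP
    simp [hE, hE', hP]

/-- Any two smooth Frobenius-sesquilinear forms of the same dimension define equivalent
functions `x ↦ h x x`. -/
theorem exists_equiv_of_isSmoothSesq [IsAlgClosed k] [FiniteDimensional k V]
    [FiniteDimensional k V'] (hVV' : Module.finrank k V = Module.finrank k V')
    (h : V →ₛₗ[iterateFrobenius k p e] V →ₗ[k] k)
    (h' : V' →ₛₗ[iterateFrobenius k p e] V' →ₗ[k] k) (hh : IsSmoothSesq h)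
    (hh' : IsSmoothSesq h') : ∃ P : V ≃ₗ[k] V', ∀ x, h' (P x) (P x) = h x x := by
  rcases eq_or_ne e 0 with rfl | he
  · exact exists_equiv_of_eq_zero _ rfl hVV'.symm h h' hh hh'
  · exact exists_equiv_of_ne_zero he _ rfl hVV'.symm h h' hh hh'

end Sesquilinear

/-! ### Functoriality of `Proj` for isomorphisms of graded algebras -/

section ProjIso

open HomogeneousLocalization

variable {k : Type u} [Field k] {A B : Type u} [CommRing A] [CommRing B] [Algebra k A] [Algebra k B]
  (𝒜 : ℕ → Submodule k A) (ℬ : ℕ → Submodule k B) [GradedAlgebra 𝒜] [GradedAlgebra ℬ]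

/-- The structure morphism of `Proj` of a graded `k`-algebra. -/
noncomputable def projStructure : Proj 𝒜 ⟶ Spec (CommRingCat.of k) :=
  Proj.toSpecZero 𝒜 ≫ Spec.map (CommRingCat.ofHom (algebraMap k (𝒜 0)))

variable {𝒜 ℬ}

/-- This is the condition under which `Proj.map` is defined on all of `Proj`. -/
theorem irrelevant_le_map_of_rightInverse (F : GradedRingHom 𝒜 ℬ) (G : GradedRingHom ℬ 𝒜)
    (hFG : ∀ x, F (G x) = x) :
    HomogeneousIdeal.irrelevant ℬ ≤ (HomogeneousIdeal.irrelevant 𝒜).map F := by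
  rw [HomogeneousIdeal.irrelevant_le]
  intro i hi x hx
  have h1 : F (G x) ∈ ((HomogeneousIdeal.irrelevant 𝒜).map F).toIdeal :=
    Ideal.mem_map_of_mem F (HomogeneousIdeal.mem_irrelevant_of_mem 𝒜 hi (G.map_mem hx))
  rw [hFG] at h1
  exact h1

theorem awayι_comp_projStructure (F : GradedRingHom 𝒜 ℬ)
    (hF : HomogeneousIdeal.irrelevant ℬ ≤ (HomogeneousIdeal.irrelevant 𝒜).map F)
    (hk : ∀ c : k, F (algebraMap k A c) = algebraMap k B c) {i : ℕ} (hi : 0 < i) (s : A)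
    (hs : s ∈ 𝒜 i) :
    Proj.awayι ℬ (F s) (F.2 hs) hi ≫ Proj.map F hF ≫ projStructure 𝒜 =
      Proj.awayι ℬ (F s) (F.2 hs) hi ≫ projStructure ℬ := by
  rw [projStructure, projStructure, Proj.awayι_comp_map_assoc F hF hi s hs,
    Proj.awayι_toSpecZero_assoc, Proj.awayι_toSpecZero_assoc, ← Spec.map_comp, ← Spec.map_comp,
    ← Spec.map_comp, ← CommRingCat.ofHom_comp, ← CommRingCat.ofHom_comp, ← CommRingCat.ofHom_comp]
  congr 2
  refine RingHom.ext fun c => ?_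
  refine HomogeneousLocalization.val_injective _ ?_
  change Localization.mk (F (algebraMap k A c)) (⟨F 1, _⟩ : Submonoid.powers (F s)) =
    Localization.mk (algebraMap k B c) (⟨1, _⟩ : Submonoid.powers (F s))
  simp only [hk, map_one]

theorem proj_map_structure (F : GradedRingHom 𝒜 ℬ)
    (hF : HomogeneousIdeal.irrelevant ℬ ≤ (HomogeneousIdeal.irrelevant 𝒜).map F)
    (hk : ∀ c : k, F (algebraMap k A c) = algebraMap k B c) :
    Proj.map F hF ≫ projStructure 𝒜 = projStructure ℬ :=
  (Proj.mapAffineOpenCover F hF).openCover.hom_ext _ _ fun s =>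
    awayι_comp_projStructure F hF hk s.1.2 _ s.2.2

theorem nonempty_iso_over_proj (E : A ≃ₐ[k] B) (hE : ∀ i, ∀ x ∈ 𝒜 i, E x ∈ ℬ i)
    (hE' : ∀ i, ∀ x ∈ ℬ i, E.symm x ∈ 𝒜 i) :
    Nonempty (Over.mk (projStructure 𝒜) ≅ Over.mk (projStructure ℬ)) := by
  let F : GradedRingHom 𝒜 ℬ := ⟨E.toAlgHom.toRingHom, fun h => hE _ _ h⟩
  let G : GradedRingHom ℬ 𝒜 := ⟨E.symm.toAlgHom.toRingHom, fun h => hE' _ _ h⟩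
  have hFG : ∀ x, F (G x) = x := E.apply_symm_apply
  have hGF : ∀ x, G (F x) = x := E.symm_apply_apply
  have hF := irrelevant_le_map_of_rightInverse F G hFG
  have hG := irrelevant_le_map_of_rightInverse G F hGF
  -- Stated for a variable `H` so that the equality with the identity can be substituted despite the
  -- dependent argument `hH`.
  have key : ∀ {A : Type u} [CommRing A] [Algebra k A] {𝒜 : ℕ → Submodule k A} [GradedAlgebra 𝒜]
      (H : GradedRingHom 𝒜 𝒜)
      (hH : HomogeneousIdeal.irrelevant 𝒜 ≤ (HomogeneousIdeal.irrelevant 𝒜).map H),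
      H = GradedRingHom.id 𝒜 → Proj.map H hH = 𝟙 _ := by
    rintro A _ _ 𝒜 _ H hH rfl
    exact Proj.map_id
  let I : Proj 𝒜 ≅ Proj ℬ :=
    { hom := Proj.map G hG
      inv := Proj.map F hF
      hom_inv_id := by
        rw [← Proj.map_comp]
        exact key _ _ (GradedRingHom.ext hGF)
      inv_hom_id := by
        rw [← Proj.map_comp]
        exact key _ _ (GradedRingHom.ext hFG) }
  exact ⟨Over.isoMk I (proj_map_structure G hG fun c => E.symm.commutes c)⟩

end ProjIso

namespace ExtremalHypersurface

theorem nonempty_projScheme_iso {σ : Type} {k : Type u} [Field k]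
    (I J : HomogeneousIdeal (homogeneousSubmodule σ k))
    (Φ : MvPolynomial σ k ≃ₐ[k] MvPolynomial σ k)
    (hΦ : ∀ d f, f.IsHomogeneous d → (Φ f).IsHomogeneous d)
    (hΦ' : ∀ d f, f.IsHomogeneous d → (Φ.symm f).IsHomogeneous d)
    (hIJ : J.toIdeal = I.toIdeal.map Φ) :
    Nonempty (projScheme I ≅ projScheme J) := by
  refine nonempty_iso_over_proj (𝒜 := quotientGrading I) (ℬ := quotientGrading J)
    (Ideal.quotientEquivAlg I.toIdeal J.toIdeal Φ hIJ) ?_ ?_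
  · rintro i _ ⟨f, hf, rfl⟩
    exact ⟨Φ f, hΦ i f hf, rfl⟩
  · rintro i _ ⟨f, hf, rfl⟩
    exact ⟨Φ.symm f, hΦ' i f hf, rfl⟩

end ExtremalHypersurface

namespace ExtremalHypersurface

/-! ### From polynomials to sesquilinear forms -/

variable {k : Type u} [Field k] {m : ℕ}

theorem exists_eq_sum_C_mul_X {L : MvPolynomial (Fin m) k} (hL : L.IsHomogeneous 1) :
    ∃ a : Fin m → k, L = ∑ j, C (a j) * X j := by
  rw [← mem_homogeneousSubmodule, homogeneousSubmodule_one_eq_span_X,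
    Submodule.mem_span_range_iff_exists_fun] at hL
  obtain ⟨a, rfl⟩ := hL
  exact ⟨a, by simp only [smul_eq_C_mul]⟩

theorem exists_linearMap {L : MvPolynomial (Fin m) k} (hL : L.IsHomogeneous 1) :
    ∃ ℓ : (Fin m → k) →ₗ[k] k, (∀ x, eval x L = ℓ x) ∧
      ∀ x j, eval x (pderiv j L) = ℓ (Pi.single j 1) := by
  obtain ⟨a, rfl⟩ := exists_eq_sum_C_mul_X hL
  refine ⟨∑ j, a j • LinearMap.proj j, fun x => ?_, fun x j => ?_⟩
  · simp
  · simp [pderiv_X, Pi.single_apply]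

/-- In `f = ∑ g_i * x_i ^ q` only the linear part of each `g_i` contributes to degree `q + 1`. -/
theorem IsFrobeniusForm.exists_coeff {p e : ℕ} {f : MvPolynomial (Fin m) k} (hf : IsFrobeniusForm p e f) :
    ∃ a : Fin m → Fin m → k, f = ∑ i, X i ^ p ^ e * ∑ j, C (a i j) * X j := by
  obtain ⟨hd, hI⟩ := hf
  rw [Ideal.mem_span_range_iff_exists_fun] at hI
  obtain ⟨g, hg⟩ := hI
  have hX : ∀ i : Fin m, (X i ^ p ^ e : MvPolynomial (Fin m) k) ∈
      homogeneousSubmodule (Fin m) k (p ^ e) := fun i => isHomogeneous_X_pow i _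
  have hlin : ∀ i, ∃ a : Fin m → k,
      (DirectSum.decompose (homogeneousSubmodule (Fin m) k) (g i) 1 : MvPolynomial (Fin m) k) =
        ∑ j, C (a j) * X j := fun i =>
    exists_eq_sum_C_mul_X (DirectSum.decompose (homogeneousSubmodule (Fin m) k) (g i) 1).2
  choose a ha using hlin
  refine ⟨a, ?_⟩
  have h1 := DirectSum.decompose_of_mem_same (homogeneousSubmodule (Fin m) k) hd
  rw [← h1, ← hg, DirectSum.decompose_sum, DFinsupp.finsetSum_apply, Submodule.coe_sum]
  refine Finset.sum_congr rfl fun i _ => ?_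
  rw [add_comm, DirectSum.coe_decompose_mul_add_of_right_mem _ (hX i), ha, mul_comm]

variable {p : ℕ} [Fact p.Prime] [CharP k p] {e : ℕ}

/-- The sesquilinear form with the matrix `a`. -/
noncomputable def matrixSesq (p e : ℕ) [Fact p.Prime] [CharP k p] (a : Fin m → Fin m → k) :
    (Fin m → k) →ₛₗ[iterateFrobenius k p e] (Fin m → k) →ₗ[k] k :=
  LinearMap.mk₂'ₛₗ _ _ (fun x y => ∑ i, x i ^ p ^ e * ∑ j, a i j * y j)
    (fun x x' y => by
      have : ExpChar k p := ExpChar.prime Fact.out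
      simp only [Pi.add_apply, add_pow_expChar_pow, add_mul, Finset.sum_add_distrib])
    (fun c x y => by
      simp only [Pi.smul_apply, smul_eq_mul, mul_pow, iterateFrobenius_def, Finset.mul_sum,
        mul_assoc])
    (fun x y y' => by
      simp only [Pi.add_apply, mul_add, Finset.sum_add_distrib])
    (fun c x y => by
      simp only [Pi.smul_apply, smul_eq_mul, RingHom.id_apply, Finset.mul_sum]
      refine Finset.sum_congr rfl fun i _ => Finset.sum_congr rfl fun j _ => ?_
      ring)

theorem matrixSesq_apply (a : Fin m → Fin m → k) (x y : Fin m → k) :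
    matrixSesq p e a x y = ∑ i, x i ^ p ^ e * ∑ j, a i j * y j :=
  rfl

/-- A Frobenius form is the function `x ↦ h x x` for a sesquilinear form `h`. -/
theorem IsFrobeniusForm.exists_sesq {f : MvPolynomial (Fin m) k} (hf : IsFrobeniusForm p e f) :
    ∃ h : (Fin m → k) →ₛₗ[iterateFrobenius k p e] (Fin m → k) →ₗ[k] k,
      (∀ x, eval x f = h x x) ∧
        ∀ x j, eval x (pderiv j f) = sesqDeriv h x (Pi.single j 1) := by
  classical
  obtain ⟨a, rfl⟩ := hf.exists_coeff
  refine ⟨matrixSesq p e a, fun x => by simp [matrixSesq_apply], fun x t => ?_⟩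
  rw [sesqDeriv, matrixSesq_apply, matrixSesq_apply]
  rcases eq_or_ne e 0 with rfl | he
  · simp [Derivation.leibniz, pderiv_X, Pi.single_apply, Finset.sum_add_distrib]
  -- The factors `x_i ^ q` have zero derivative, so only the term `h x y` survives.
  · have hq : ((p ^ e : ℕ) : k) = 0 := by
      rw [Nat.cast_pow, CharP.cast_eq_zero, zero_pow he]
    simp only [Nat.cast_pow] at hq
    simp [Derivation.leibniz, Derivation.leibniz_pow, pderiv_X, Pi.single_apply, he]

/-- The restriction of `h` to a hyperplane giving a smooth section is smooth. -/
theorem IsSmoothIntersection.isSmoothSesq {f L : MvPolynomial (Fin m) k}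
    (hs : IsSmoothIntersection ![f, L])
    {h : (Fin m → k) →ₛₗ[iterateFrobenius k p e] (Fin m → k) →ₗ[k] k}
    (hf : ∀ x, eval x f = h x x)
    (hf' : ∀ x j, eval x (pderiv j f) = sesqDeriv h x (Pi.single j 1))
    {ℓ : (Fin m → k) →ₗ[k] k} (hL : ∀ x, eval x L = ℓ x)
    (hL' : ∀ x j, eval x (pderiv j L) = ℓ (Pi.single j 1)) {z : Fin m → k} (hz : ℓ z = 1) :
    IsSmoothSesq (sesqRestrict h (LinearMap.ker ℓ)) := by
  intro x hx hx'
  by_contra hx0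
  have hli := hs x (fun h0 => hx0 (Subtype.ext h0)) (by
    intro i
    fin_cases i
    · exact (hf x).trans hx
    · exact (hL x).trans x.2)
  have hvec : (fun (i : Fin 2) (j : Fin m) => eval (x : Fin m → k) (pderiv j (![f, L] i))) =
      ![fun j => sesqDeriv h x (Pi.single j 1), fun j => ℓ (Pi.single j 1)] := by
    funext i j
    fin_cases i
    · exact hf' x j
    · exact hL' x j
  rw [hvec, LinearIndependent.pair_iff] at hli
  -- At a singular point of the restriction the derivative of `f` vanishes on the hyperplane, so it
  -- is a multiple of `ℓ`, against the independence of the gradients.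
  have hD : ∀ y, sesqDeriv h x y = ℓ y * sesqDeriv h x z := by
    intro y
    have h1 : sesqDeriv h x (y - ℓ y • z) = 0 :=
      hx' ⟨y - ℓ y • z, by rw [LinearMap.mem_ker, map_sub, map_smul, hz, smul_eq_mul, mul_one,
        sub_self]⟩
    rcases eq_or_ne e 0 with rfl | he
    · simp only [sesqDeriv, if_true, map_sub, LinearMap.sub_apply, map_smul, sesq_smul_left,
        smul_eq_mul, pow_zero, pow_one] at h1 ⊢
      linear_combination h1
    · simp only [sesqDeriv, if_neg he, map_sub, map_smul, smul_eq_mul] at h1 ⊢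
      linear_combination h1
  have := hli 1 (-sesqDeriv h x z) (by
    funext j
    simp only [Pi.add_apply, Pi.smul_apply, smul_eq_mul, Pi.zero_apply]
    rw [hD (Pi.single j 1)]
    ring)
  exact one_ne_zero this.1

/-- The partial derivatives are `x_j ^ q` for `e > 0` and `2 * x_j` for `e = 0`. In the excluded
case the diagonal form is the square of a linear form. -/
theorem exists_sesq_diagonalForm (n : ℕ) (hpe : e ≠ 0 ∨ p ≠ 2) :
    ∃ h : (Fin n → k) →ₛₗ[iterateFrobenius k p e] (Fin n → k) →ₗ[k] k,
      (∀ x, eval x (diagonalForm k p e n) = h x x) ∧ IsSmoothSesq h := by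
  have hp : p.Prime := Fact.out
  have hh : ∀ x y : Fin n → k,
      matrixSesq p e (fun i j => if i = j then 1 else 0) x y = ∑ i, x i ^ p ^ e * y i := by
    intro x y
    simp [matrixSesq_apply]
  refine ⟨matrixSesq p e fun i j => if i = j then 1 else 0, fun x => ?_, fun x _ hx => ?_⟩
  · rw [hh]
    simp [diagonalForm, pow_succ]
  · funext j
    have := hx (Pi.single j 1)
    rw [sesqDeriv, hh, hh] at this
    rcases eq_or_ne e 0 with rfl | he
    · have h2 : (2 : k) ≠ 0 := by
        intro h2
        have : (p : ℕ) ∣ 2 := (CharP.cast_eq_zero_iff k p 2).1 (by exact_mod_cast h2)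
        rcases hpe with h | h
        · exact h rfl
        · exact h ((Nat.prime_dvd_prime_iff_eq hp Nat.prime_two).1 this)
      simp [Pi.single_apply, ← two_mul, h2] at this
      simpa using this
    · simpa [Pi.single_apply, he, hp.ne_zero] using this

/-! ### Linear substitutions -/

theorem eval_linearSubst {r : ℕ} (M : Matrix (Fin m) (Fin r) k) (f : MvPolynomial (Fin m) k)
    (x : Fin r → k) : eval x (linearSubst M f) = eval (M.mulVec x) f := by
  induction f using MvPolynomial.induction_on with
  | C a => simp [linearSubst]
  | add f g hf hg => rw [map_add, map_add, map_add, hf, hg]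
  | mul_X f i hf =>
    rw [map_mul, map_mul, map_mul, hf, eval_X]
    simp [linearSubst, Matrix.mulVec, dotProduct]

theorem isHomogeneous_linearSubst {r d : ℕ} (M : Matrix (Fin m) (Fin r) k)
    {f : MvPolynomial (Fin m) k} (hf : f.IsHomogeneous d) :
    (linearSubst M f).IsHomogeneous d := by
  have := hf.aeval (fun i => ∑ j, C (M i j) * X j) (n := 1) fun i =>
    IsHomogeneous.sum _ _ _ fun j _ => isHomogeneous_C_mul_X _ _
  rwa [one_mul] at this

/-- The automorphism of the polynomial ring given by a linear automorphism. -/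
noncomputable def linearSubstEquiv [Infinite k] (T : (Fin m → k) ≃ₗ[k] (Fin m → k)) :
    MvPolynomial (Fin m) k ≃ₐ[k] MvPolynomial (Fin m) k :=
  AlgEquiv.ofAlgHom (linearSubst (LinearMap.toMatrix' T.toLinearMap))
    (linearSubst (LinearMap.toMatrix' T.symm.toLinearMap))
    (AlgHom.ext fun f => MvPolynomial.funext fun x => by
      simp [eval_linearSubst, LinearMap.toMatrix'_mulVec])
    (AlgHom.ext fun f => MvPolynomial.funext fun x => by
      simp [eval_linearSubst, LinearMap.toMatrix'_mulVec])

theorem eval_linearSubstEquiv [Infinite k] (T : (Fin m → k) ≃ₗ[k] (Fin m → k))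
    (f : MvPolynomial (Fin m) k) (x : Fin m → k) :
    eval x (linearSubstEquiv T f) = eval (T x) f := by
  simp [linearSubstEquiv, eval_linearSubst, LinearMap.toMatrix'_mulVec]

/-- A polynomial vanishing on the hyperplane `V(L)` is divisible by `L`. -/
theorem mem_span_of_eval_eq_zero [Infinite k] {L g : MvPolynomial (Fin m) k}
    {ℓ : (Fin m → k) →ₗ[k] k} (hL : ∀ x, eval x L = ℓ x) {z : Fin m → k} (hz : ℓ z = 1)
    (hg : ∀ x, ℓ x = 0 → eval x g = 0) : g ∈ Ideal.span {L} := by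
  -- `s` is the pullback along the projection `x ↦ x - ℓ x • z` onto the hyperplane: it kills `g`
  -- and is the identity modulo `L`.
  let s : MvPolynomial (Fin m) k →ₐ[k] MvPolynomial (Fin m) k := aeval fun j => X j - C (z j) * L
  have h0 : s g = 0 := by
    refine MvPolynomial.funext fun x => ?_
    have h1 : eval x (s g) = eval (x - ℓ x • z) g := by
      clear hg
      induction g using MvPolynomial.induction_on with
      | C a => simp [s]
      | add f g hf hg => rw [map_add, map_add, map_add, hf, hg]
      | mul_X f i hf =>
        rw [map_mul, map_mul, map_mul, hf, eval_X]
        simp [s, hL, mul_comm]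
    rw [h1, map_zero]
    exact hg _ (by rw [map_sub, map_smul, hz, smul_eq_mul, mul_one, sub_self])
  have h2 : (Ideal.Quotient.mkₐ k (Ideal.span {L})).comp s =
      Ideal.Quotient.mkₐ k (Ideal.span {L}) := by
    refine MvPolynomial.algHom_ext fun j => ?_
    rw [AlgHom.comp_apply, aeval_X, Ideal.Quotient.mkₐ_eq_mk, Ideal.Quotient.eq]
    refine Ideal.mem_span_singleton.2 ⟨-C (z j), by ring⟩
  have h3 := DFunLike.congr_fun h2 g
  rw [AlgHom.comp_apply, h0, map_zero] at h3
  exact Ideal.Quotient.eq_zero_iff_mem.1 h3.symm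

end ExtremalHypersurface

/-! ### Hyperplane sections -/

namespace ExtremalHypersurface

variable {k : Type u} [Field k]

/-- An isomorphism between two hyperplanes extends to the whole space. -/
theorem exists_extension {V : Type*} [AddCommGroup V] [Module k V] [FiniteDimensional k V]
    {ℓ₁ ℓ₂ : V →ₗ[k] k} {z₁ z₂ : V} (h₁ : ℓ₁ z₁ = 1) (h₂ : ℓ₂ z₂ = 1)
    (P : LinearMap.ker ℓ₁ ≃ₗ[k] LinearMap.ker ℓ₂) :
    ∃ T : V ≃ₗ[k] V, (∀ x, ℓ₂ (T x) = ℓ₁ x) ∧ ∀ x : LinearMap.ker ℓ₁, T x = P x := by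
  -- `π` projects along `z₁`, and `F` is `P` on the kernel and sends `z₁` to `z₂`.
  let π : V →ₗ[k] LinearMap.ker ℓ₁ :=
    (LinearMap.id - (LinearMap.toSpanSingleton k V z₁).comp ℓ₁).codRestrict _ fun x => by
      simp [h₁]
  let F : V →ₗ[k] V := (LinearMap.ker ℓ₂).subtype.comp (P.toLinearMap.comp π) +
    (LinearMap.toSpanSingleton k V z₂).comp ℓ₁
  have hF : ∀ x, F x = P (π x) + ℓ₁ x • z₂ := fun x => by simp [F]
  have hπ : ∀ x, (π x : V) = x - ℓ₁ x • z₁ := fun x => by simp [π]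
  have hπ' : ∀ x : LinearMap.ker ℓ₁, π x = x := fun x => Subtype.ext (by
    have : ℓ₁ x = 0 := x.2
    rw [hπ, this, zero_smul, sub_zero])
  have hP : ∀ y, ℓ₂ (P y) = 0 := fun y => (P y).2
  have hℓ : ∀ x, ℓ₂ (F x) = ℓ₁ x := fun x => by
    rw [hF, map_add, hP, map_smul, h₂, smul_eq_mul, mul_one, zero_add]
  have hFP : ∀ x : LinearMap.ker ℓ₁, F x = P x := fun x => by
    have : ℓ₁ x = 0 := x.2
    rw [hF, hπ', this, zero_smul, add_zero]
  have hinj : Function.Injective F := by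
    refine (injective_iff_map_eq_zero F).2 fun x hx => ?_
    have h0 : x ∈ LinearMap.ker ℓ₁ := by
      rw [LinearMap.mem_ker, ← hℓ, hx, map_zero]
    have h1 := hFP ⟨x, h0⟩
    rw [hx] at h1
    have h2 : P ⟨x, h0⟩ = 0 := Subtype.ext h1.symm
    exact congrArg Subtype.val ((map_eq_zero_iff P P.injective).1 h2)
  exact ⟨LinearEquiv.ofInjectiveEndo F hinj, hℓ, hFP⟩

variable [IsAlgClosed k] {p : ℕ} [Fact p.Prime] [CharP k p] {e n : ℕ}
  {f : MvPolynomial (Fin (n + 1)) k}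

/-- The linear form and the smooth sesquilinear form attached to a smooth hyperplane section. -/
theorem exists_section_data {L : MvPolynomial (Fin (n + 1)) k} (hL : L.IsHomogeneous 1)
    (hL0 : L ≠ 0) (hs : IsSmoothIntersection ![f, L])
    {h : (Fin (n + 1) → k) →ₛₗ[iterateFrobenius k p e] (Fin (n + 1) → k) →ₗ[k] k}
    (hf : ∀ x, eval x f = h x x)
    (hf' : ∀ x j, eval x (pderiv j f) = sesqDeriv h x (Pi.single j 1)) :
    ∃ (ℓ : (Fin (n + 1) → k) →ₗ[k] k) (z : Fin (n + 1) → k), (∀ x, eval x L = ℓ x) ∧ ℓ z = 1 ∧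
      Module.finrank k (LinearMap.ker ℓ) = n ∧
        IsSmoothSesq (sesqRestrict h (LinearMap.ker ℓ)) := by
  obtain ⟨ℓ, hℓ, hℓ'⟩ := exists_linearMap hL
  have hℓ0 : ℓ ≠ 0 := by
    rintro rfl
    exact hL0 (MvPolynomial.funext fun x => by rw [hℓ, map_zero, LinearMap.zero_apply])
  obtain ⟨y, hy⟩ : ∃ y, ℓ y ≠ 0 := by
    by_contra! H
    exact hℓ0 (LinearMap.ext H)
  have hz : ℓ ((ℓ y)⁻¹ • y) = 1 := by rw [map_smul, smul_eq_mul, inv_mul_cancel₀ hy]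
  refine ⟨ℓ, _, hℓ, hz, ?_, hs.isSmoothSesq hf hf' hℓ hℓ' hz⟩
  have := Module.Dual.finrank_ker_add_one_of_ne_zero hℓ0
  rw [Module.finrank_fin_fun] at this
  omega

theorem nonempty_hyperplaneSection_iso (hf : IsFrobeniusForm p e f)
    {L₁ L₂ : MvPolynomial (Fin (n + 1)) k} (hL₁ : L₁.IsHomogeneous 1) (hL₂ : L₂.IsHomogeneous 1)
    (h₁ : L₁ ≠ 0) (h₂ : L₂ ≠ 0) (hs₁ : IsSmoothIntersection ![f, L₁])
    (hs₂ : IsSmoothIntersection ![f, L₂]) :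
    Nonempty (hyperplaneSection hf.1 hL₁ ≅ hyperplaneSection hf.1 hL₂) := by
  have : Infinite k := IsAlgClosed.instInfinite
  obtain ⟨h, hh, hh'⟩ := hf.exists_sesq
  obtain ⟨ℓ₁, z₁, hℓ₁, hz₁, hd₁, hS₁⟩ := exists_section_data hL₁ h₁ hs₁ hh hh'
  obtain ⟨ℓ₂, z₂, hℓ₂, hz₂, hd₂, hS₂⟩ := exists_section_data hL₂ h₂ hs₂ hh hh'
  -- `P` goes from the second hyperplane to the first because polynomials pull back: substitution
  -- along `T` must send `L₁` to `L₂`.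
  obtain ⟨P, hP⟩ := exists_equiv_of_isSmoothSesq (hd₂.trans hd₁.symm) _ _ hS₂ hS₁
  obtain ⟨T, hT, hTP⟩ := exists_extension hz₂ hz₁ P
  have hL : linearSubstEquiv T L₁ = L₂ := MvPolynomial.funext fun x => by
    rw [eval_linearSubstEquiv, hℓ₁, hT, hℓ₂]
  -- The pullback of `f` agrees with `f` only on `V(L₂)`, hence modulo `L₂`; this is enough to match
  -- the ideals.
  obtain ⟨g, hg⟩ : ∃ g, g * L₂ = linearSubstEquiv T f - f := by
    refine Ideal.mem_span_singleton'.1 (mem_span_of_eval_eq_zero hℓ₂ hz₂ fun x hx => ?_)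
    have h1 := hTP ⟨x, hx⟩
    have h2 := hP ⟨x, hx⟩
    simp only [sesqRestrict_apply] at h2
    rw [map_sub, eval_linearSubstEquiv, hh, hh, h1, h2, sub_self]
  refine nonempty_projScheme_iso _ _ (linearSubstEquiv T)
    (fun d f hf => isHomogeneous_linearSubst _ hf)
    (fun d f hf => isHomogeneous_linearSubst _ hf) ?_
  change Ideal.span {f, L₂} = (Ideal.span {f, L₁}).map (linearSubstEquiv T)
  rw [Ideal.map_span, Set.image_pair, hL]
  refine le_antisymm (Ideal.span_le.2 ?_) (Ideal.span_le.2 ?_)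
  · rintro _ (rfl | rfl)
    · exact Ideal.mem_span_pair.2 ⟨1, -g, by linear_combination -hg⟩
    · exact Ideal.subset_span (Or.inr rfl)
  · rintro _ (rfl | rfl)
    · exact Ideal.mem_span_pair.2 ⟨1, g, by linear_combination hg⟩
    · exact Ideal.subset_span (Or.inr rfl)

theorem sectionProjectivelyEquivalent_diagonalForm (hf : IsFrobeniusForm p e f)
    (hpe : e ≠ 0 ∨ p ≠ 2) {L : MvPolynomial (Fin (n + 1)) k} (hL : L.IsHomogeneous 1)
    (hL0 : L ≠ 0) (hs : IsSmoothIntersection ![f, L]) :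
    SectionProjectivelyEquivalent f L (diagonalForm k p e n) := by
  have : Infinite k := IsAlgClosed.instInfinite
  obtain ⟨h, hh, hh'⟩ := hf.exists_sesq
  obtain ⟨ℓ, z, hℓ, hz, hd, hS⟩ := exists_section_data hL hL0 hs hh hh'
  obtain ⟨h₀, hh₀, hS₀⟩ := exists_sesq_diagonalForm (k := k) (p := p) (e := e) n hpe
  obtain ⟨P, hP⟩ := exists_equiv_of_isSmoothSesq
    ((Module.finrank_fin_fun k).trans hd.symm) _ _ hS₀ hS
  have hM : ∀ x, (LinearMap.toMatrix' ((LinearMap.ker ℓ).subtype.comp P.toLinearMap)).mulVec x =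
      (P x : Fin (n + 1) → k) := fun x => by
    rw [LinearMap.toMatrix'_mulVec]
    rfl
  refine ⟨LinearMap.toMatrix' ((LinearMap.ker ℓ).subtype.comp P.toLinearMap), ⟨?_, ?_⟩, ?_⟩
  · intro x y hxy
    rw [hM, hM] at hxy
    exact P.injective (Subtype.ext hxy)
  · ext x
    simp only [Set.mem_range, Set.mem_ofPred_eq, hM, hℓ]
    constructor
    · rintro ⟨y, rfl⟩
      exact (P y).2
    · intro hx
      exact ⟨P.symm ⟨x, hx⟩, by rw [LinearEquiv.apply_symm_apply]⟩
  -- The pullback is the diagonal form itself, not merely a multiple; as `k` is infinite, comparing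
  -- values suffices.
  · congr 2
    refine MvPolynomial.funext fun x => ?_
    rw [eval_linearSubst, hM, hh, hh₀, ← hP]
    rfl

end ExtremalHypersurface

theorem corollary8p2 {k : Type u} [Field k] [IsAlgClosed k] (p : ℕ) [Fact p.Prime] [CharP k p]
    (e n : ℕ) (hn : 1 ≤ n) (f : MvPolynomial (Fin (n + 1)) k)
    (hf : ExtremalHypersurface.IsFrobeniusForm p e f)
    (hX : ExtremalHypersurface.IsSmoothIntersection ![f]) :
    (∀ (L₁ L₂ : MvPolynomial (Fin (n + 1)) k) (hL₁ : L₁.IsHomogeneous 1)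
      (hL₂ : L₂.IsHomogeneous 1), L₁ ≠ 0 → L₂ ≠ 0 →
      ExtremalHypersurface.IsSmoothIntersection ![f, L₁] →
      ExtremalHypersurface.IsSmoothIntersection ![f, L₂] →
      Nonempty (ExtremalHypersurface.hyperplaneSection hf.1 hL₁ ≅
        ExtremalHypersurface.hyperplaneSection hf.1 hL₂)) ∧
    (e ≠ 0 ∨ p ≠ 2 →
      ∀ L : MvPolynomial (Fin (n + 1)) k, L.IsHomogeneous 1 → L ≠ 0 →
      ExtremalHypersurface.IsSmoothIntersection ![f, L] →
      ExtremalHypersurface.SectionProjectivelyEquivalent f L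
        (ExtremalHypersurface.diagonalForm k p e n)) := by
  exact ⟨fun _ _ hL₁ hL₂ h₁ h₂ hs₁ hs₂ =>
    ExtremalHypersurface.nonempty_hyperplaneSection_iso hf hL₁ hL₂ h₁ h₂ hs₁ hs₂,
    fun hpe _ hL hL0 hs =>
      ExtremalHypersurface.sectionProjectivelyEquivalent_diagonalForm hf hpe hL hL0 hs⟩
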